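/- **Setting.** Let $M$ be a non-empty closed 3-manifold with a finite triangulation $\mathcal T$ with vertex set $\mathcal T_0=\{1,\dots,N\}$ and set of tetrahedra $\mathcal T_3$, a tetrahedron being written $\{ijkl\}$ by its four vertices. The tetra-degree $d_i$ of a vertex $i$ is the number of tetrahedra containing $i$. A ball packing is a vector $\boldsymbol r\in(0,\infty)^N$. For $\{ijkl\}\in\mathcal T_3$ put $y_m=\coth r_m$ and $$Q=(y_i+y_j+y_k+y_l)^2-2(y_i^2+y_j^2+y_k^2+y_l^2)+4 .$$ The tetrahedron is called real if $Q>0$; then there is a non-degenerate tetrahedron in hyperbolic 3-space $\mathbb H^3$, unique up to isometry, with edge lengths $l_{ab}=r_a+r_b$. Otherwise it is called virtual. A ball packing is real if all its tetrahedra are real, and virtual otherwise. The extended solid angle $\widetilde\alpha_{ijkl}$ at the vertex $i$ is the solid angle at $i$ of that hyperbolic tetrahedron if $Q>0$. If $Q\le 0$, it is $2\pi$ when $$y_i\ge y_j+y_k+y_l+2\sqrt{y_jy_k+y_ky_l+y_ly_j+1},$$ and $0$ otherwise. The extended combinatorial scalar curvature at $i$ is $\widetilde K_i(\boldsymbol r)=4\pi-\sum\widetilde\alpha_{ijkl}$,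 the sum being over the tetrahedra containing $i$. A solution of the extended combinatorial Yamabe flow on $[0,b)$, $0<b\le\infty$, is a function $\boldsymbol r:[0,b)\to(0,\infty)^N$ with $$\frac{dr_i}{dt}=-\widetilde K_i(\boldsymbol r)\sinh r_i\qquad\text{for all } i\in\mathcal T_0 .$$ **Theorem.** Suppose $d_i\le 22$ for every $i\in\mathcal T_0$. Then there is no ball packing $\boldsymbol r$, real or virtual, with $\widetilde K_i(\boldsymbol r)=0$ for all $i\in\mathcal T_0$. Moreover, put $\varepsilon_0=4\pi-22\,(3\arccos\tfrac13-\pi)$ and $r_M(t)=\max_i r_i(t)$. Then $\varepsilon_0>0$, and every solution of the extended flow on $[0,b)$, $0<b\le\infty$, with arbitrary initial data $\boldsymbol r(0)\in(0,\infty)^N$, satisfies $$\tanh\frac{r_M(t)}2\le \tanh\frac{r_M(0)}2\; e^{-\varepsilon_0 t}\qquad\text{for all } t\in[0,b).$$ In particular, every solution defined on $[0,\infty)$ satisfies $\boldsymbol r(t)\to\boldsymbol 0$ as $t\to\infty$. -/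

import Mathlib

noncomputable section

namespace BallPacking

/-! ### Triangulated 3-manifolds -/

/-- The geometric realization of a finite abstract simplicial complex, in barycentric coordinates:
points of the standard simplex on the vertex set whose support lies in a face. It carries the
subspace topology of `V → ℝ`. -/
def realization {V : Type*} [Fintype V] (K : AbstractSimplicialComplex V) : Set (V → ℝ) :=
  {x | x ∈ stdSimplex ℝ V ∧ ∃ s ∈ K.faces, ∀ v, x v ≠ 0 → v ∈ s}

/-- A (finite) triangulation of the space `M` with vertex set `V`: an abstract simplicial complex
in which every element of `V` is a vertex, with a homeomorphism of its realization onto `M`. -/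
structure Triangulation (V : Type*) [Fintype V] (M : Type*) [TopologicalSpace M] where
  complex : AbstractSimplicialComplex V
  homeo : realization complex ≃ₜ M

open Classical in
/-- The set of tetrahedra, each one given by its set of four vertices. -/
def Triangulation.tetrahedra {V : Type*} [Fintype V] {M : Type*} [TopologicalSpace M]
    (T : Triangulation V M) : Finset (Finset V) :=
  {s | s ∈ T.complex.faces ∧ s.card = 4}

open Classical in
/-- The tetra-degree of a vertex: the number of tetrahedra incident to it. -/
def Triangulation.tetraDegree {V : Type*} [Fintype V] {M : Type*} [TopologicalSpace M]
    (T : Triangulation V M) (i : V) : ℕ :=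
  {s ∈ T.tetrahedra | i ∈ s}.card

/-! ### Hyperbolic 3-space -/

/-- Euclidean 3-space. -/
abbrev E3 : Type := EuclideanSpace ℝ (Fin 3)

/-- The Lorentz form on `ℝ × E3`; the first coordinate is the time coordinate. -/
def lorentz (p q : ℝ × E3) : ℝ := inner ℝ p.2 q.2 - p.1 * q.1

/-- The hyperboloid model of hyperbolic 3-space (curvature `-1`). -/
def hyperbolicSpace : Set (ℝ × E3) := {p | lorentz p p = -1 ∧ 0 < p.1}

/-- The hyperbolic distance. -/
def hyperbolicDist (p q : ℝ × E3) : ℝ := Real.arcosh (-lorentz p q)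

/-- The base point of the hyperboloid. Its tangent space is `0 × E3`, on which the Riemannian
metric is the Euclidean one. -/
def basePoint : ℝ × E3 := (1, 0)

/-! ### Solid angles

In this section `s` is a tetrahedron, given by its set of four vertices, and `r` assigns radii to
the vertices. -/

/-- The points `p j`, `j ∈ s`, are the vertices of a hyperbolic tetrahedron whose edge lengths are
`r j + r k`, that is, the centres of mutually tangent balls of radii `r j`. -/
def IsTangentBallTetrahedron {V : Type*} (s : Finset V) (r : V → ℝ) (p : V → ℝ × E3) : Prop :=
  (∀ j ∈ s, p j ∈ hyperbolicSpace) ∧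
    ∀ j ∈ s, ∀ k ∈ s, j ≠ k → hyperbolicDist (p j) (p k) = r j + r k

/-- The area on the unit sphere of the set of directions in the cone spanned by the vectors `x j`,
`j ∈ s`. -/
def coneSolidAngle {V : Type*} (s : Finset V) (x : V → E3) : ℝ :=
  (MeasureTheory.volume : MeasureTheory.Measure E3).toSphere.real
    {u | ∃ c : V → ℝ, (∀ j ∈ s, 0 ≤ c j) ∧ (u : E3) = ∑ j ∈ s, c j • x j}

open Classical in
/-- The solid angle at the vertex `i` of the hyperbolic tetrahedron with edge lengths `r j + r k`.
This tetrahedron is unique up to isometry, and is placed with the vertex `i` at the base point `o`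
of the hyperboloid. The geodesic from `o` to another vertex `(t, x)` leaves `o` in the direction
of `x`, so the directions at `o` that point into the tetrahedron form the cone spanned by the
space coordinates of its other vertices. Used only for real tetrahedra, which do exist. -/
def solidAngle {V : Type*} (s : Finset V) (r : V → ℝ) (i : V) : ℝ :=
  if h : ∃ p : V → ℝ × E3, IsTangentBallTetrahedron s r p ∧ p i = basePoint then
    coneSolidAngle (s.erase i) (fun j => (h.choose j).2)
  else 0

/-- The hyperbolic cotangent. -/
def coth (x : ℝ) : ℝ := Real.cosh x / Real.sinh x

/-- The quantity `Q`: the tetrahedron is real (non-degenerate) if and only if `0 < Q`, and virtual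
otherwise. -/
def Q {V : Type*} (s : Finset V) (r : V → ℝ) : ℝ :=
  (∑ j ∈ s, coth (r j)) ^ 2 - 2 * ∑ j ∈ s, coth (r j) ^ 2 + 4

open Classical in
/-- The radii `r` lie in the `i`-th virtual tetrahedron space `D_i`. With `y = coth r` and
`s = {i, j, k, l}` this is
`y_i ≥ y_j + y_k + y_l + 2 √(y_j y_k + y_k y_l + y_l y_j + 1)`. -/
def InVirtualSpace {V : Type*} (s : Finset V) (r : V → ℝ) (i : V) : Prop :=
  ∑ j ∈ s.erase i, coth (r j) +
    2 * √((∑ e ∈ (s.erase i).powersetCard 2, ∏ j ∈ e, coth (r j)) + 1) ≤ coth (r i)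

open Classical in
/-- The extended solid angle at the vertex `i` of the tetrahedron `s`: the solid angle if `s` is
real, `2π` on `D_i`, and `0` on the other three virtual spaces (the four virtual spaces are disjoint
and cover all virtual tetrahedra). -/
def extSolidAngle {V : Type*} (s : Finset V) (r : V → ℝ) (i : V) : ℝ :=
  if 0 < Q s r then solidAngle s r i
  else if InVirtualSpace s r i then 2 * Real.pi
  else 0

/-! ### Ball packings, curvature and the flow -/

/-- A ball packing, real or virtual: a positive radius at each vertex. -/
def IsBallPacking {V : Type*} (r : V → ℝ) : Prop := ∀ i, 0 < r i

open Classical in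
/-- The extended combinatorial scalar curvature at the vertex `i`. -/
def Triangulation.extCurvature {V : Type*} [Fintype V] {M : Type*} [TopologicalSpace M]
    (T : Triangulation V M) (r : V → ℝ) (i : V) : ℝ :=
  4 * Real.pi - ∑ s ∈ T.tetrahedra with i ∈ s, extSolidAngle s r i

/-- The time interval `[0, b)`, where `b` may be infinite. -/
def timeInterval (b : EReal) : Set ℝ := {t | 0 ≤ t ∧ (t : EReal) < b}

/-- `r` is a solution of the extended combinatorial Yamabe flow
`dr_i/dt = - K_i sinh r_i` on the time interval `[0, b)` (the derivative at `0` is one-sided). -/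
def Triangulation.IsExtYamabeFlow {V : Type*} [Fintype V] {M : Type*} [TopologicalSpace M]
    (T : Triangulation V M) (b : EReal) (r : ℝ → V → ℝ) : Prop :=
  ∀ t ∈ timeInterval b, IsBallPacking (r t) ∧
    ∀ i, HasDerivWithinAt (fun τ => r τ i) (-T.extCurvature (r t) i * Real.sinh (r t i))
      (timeInterval b) t

/-- The largest radius `r_M`. -/
def maxRadius {V : Type*} (r : V → ℝ) : ℝ := ⨆ i, r i

/-- The constant `ε₀ = 4π - 22 (3 arccos(1/3) - π)`. -/
def decayRate : ℝ := 4 * Real.pi - 22 * (3 * Real.arccos (1 / 3) - Real.pi)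

end BallPacking

end

/-! Everything reduces to one bound: at the centre of a largest ball, with radius `r i`, each
extended solid angle is at most `3 * arccos (1/3) - π`, the solid angle of the regular Euclidean
tetrahedron. With at most 22 tetrahedra at that vertex, the curvature there is at least `decayRate`,
which is positive, so the curvature cannot vanish everywhere.

For a real tetrahedron, the hyperbolic law of cosines turns "face angle at `i` at most `π / 3`" into
`4 sinh (r j) sinh (r k) ≤ sinh (r i + r j) sinh (r i + r k)`, which holds because `r i` is maximal
(`IsTangentBallTetrahedron.norm_mul_norm_le`). It remains to bound the area of a spherical triangle
with sides at most `π / 3` (`toSphere_real_cone_le`). Girard's theorem, proved by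
inclusion–exclusion of half-balls, gives the area `E` as an angle excess; in terms of the cosines
`A, B, C` of the sides, `tan (E / 2) = d / (1 + A + B + C)` with `d ^ 2` the Gram determinant, and
`gram_det_le` bounds this by its value at `A = B = C = 1 / 2`. A virtual tetrahedron contributes `0`
at `i`, since the angle `2π` would need `coth (r i)` to exceed the other three, while it is the
smallest of them.

Along the flow, `tanh (r i / 2)` has derivative `-K i * tanh (r i / 2)`. Hence `exp (decayRate * t)
* tanh (r i / 2)` has nonpositive derivative whenever `i` attains the maximum, and a maximum
principle for finitely many functions gives the decay. -/

namespace BallPacking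

open MeasureTheory Set Filter Topology
open scoped ENNReal RealInnerProductSpace Pointwise

/-! ### Wedges of the unit ball and their volumes -/

/-- The volume of a wedge-shaped part of the unit ball, cut out by a condition on the polar angle
in the first two coordinates, is proportional to the measure of the set of admissible angles. -/
lemma exists_volume_angular_sector :
    ∃ c : ℝ≥0∞, ∀ (W : Set (ℝ × ℝ)) (S : Set ℝ), MeasurableSet W → MeasurableSet S →
      (∀ ρ φ : ℝ, 0 < ρ → φ ∈ Ioo (-Real.pi) Real.pi →
        ((ρ * Real.cos φ, ρ * Real.sin φ) ∈ W ↔ φ ∈ S)) →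
      volume {v : E3 | ‖v‖ < 1 ∧ (v 0, v 1) ∈ W} =
        c * volume (S ∩ Ioo (-Real.pi) Real.pi) := by
  -- The radial factor of the integral in cylindrical coordinates. It need not be evaluated: the
  -- full ball determines it later.
  refine ⟨∫⁻ ρ in Ioi (0 : ℝ), ENNReal.ofReal ρ * volume {z : ℝ | z ^ 2 + ρ ^ 2 < 1}, ?_⟩
  intro W S hW hS hWS
  have hmeas : MeasurableSet {q : ℝ × (ℝ × ℝ) | q.1 ^ 2 + (q.2.1 ^ 2 + q.2.2 ^ 2) < 1 ∧ q.2 ∈ W} :=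
    MeasurableSet.inter (s₁ := {q : ℝ × (ℝ × ℝ) | q.1 ^ 2 + (q.2.1 ^ 2 + q.2.2 ^ 2) < 1})
      (measurableSet_lt (by fun_prop) (by fun_prop)) (measurable_snd hW)
  have hg : Measurable fun ρ : ℝ => volume {z : ℝ | z ^ 2 + ρ < 1} := by
    have h : MeasurableSet {q : ℝ × ℝ | q.1 ^ 2 + q.2 < 1} :=
      measurableSet_lt (by fun_prop) (by fun_prop)
    exact measurable_measure_prodMk_right (μ := (volume : Measure ℝ)) h
  have he := ((MeasurePreserving.id (volume : Measure ℝ)).prod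
    (volume_preserving_finTwoArrow ℝ)).comp
      ((volume_preserving_piFinSuccAbove (fun _ : Fin 3 => ℝ) 2).comp
        (PiLp.volume_preserving_ofLp (Fin 3)))
  have hpre : {v : E3 | ‖v‖ < 1 ∧ (v 0, v 1) ∈ W} =
      (Prod.map id (MeasurableEquiv.finTwoArrow (α := ℝ)) ∘
        (MeasurableEquiv.piFinSuccAbove (fun _ : Fin 3 => ℝ) 2) ∘ WithLp.ofLp) ⁻¹'
        {q : ℝ × (ℝ × ℝ) | q.1 ^ 2 + (q.2.1 ^ 2 + q.2.2 ^ 2) < 1 ∧ q.2 ∈ W} := by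
    ext v
    have hn : ‖v‖ < 1 ↔ v 2 ^ 2 + (v 0 ^ 2 + v 1 ^ 2) < 1 := by
      rw [EuclideanSpace.norm_eq, Real.sqrt_lt' one_pos, Fin.sum_univ_three]
      simp only [Real.norm_eq_abs, sq_abs, one_pow]
      constructor <;> intro h <;> linarith
    simp only [mem_ofPred_eq, mem_preimage, Function.comp_apply, hn]
    rfl
  rw [hpre, he.measure_preimage hmeas.nullMeasurableSet, Measure.prod_apply_symm hmeas]
  have h1 : ∀ p : ℝ × ℝ, volume ((fun z : ℝ => (z, p)) ⁻¹'
      {q : ℝ × (ℝ × ℝ) | q.1 ^ 2 + (q.2.1 ^ 2 + q.2.2 ^ 2) < 1 ∧ q.2 ∈ W}) =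
      W.indicator (fun p => volume {z : ℝ | z ^ 2 + (p.1 ^ 2 + p.2 ^ 2) < 1}) p := by
    intro p
    by_cases hp : p ∈ W <;> simp [hp]
  simp_rw [h1]
  rw [← lintegral_comp_polarCoord_symm, polarCoord_target]
  have h2 : ∀ p ∈ Ioi (0 : ℝ) ×ˢ Ioo (-Real.pi) Real.pi,
      ENNReal.ofReal p.1 • W.indicator
        (fun p => volume {z : ℝ | z ^ 2 + (p.1 ^ 2 + p.2 ^ 2) < 1}) (polarCoord.symm p) =
      (ENNReal.ofReal p.1 * volume {z : ℝ | z ^ 2 + p.1 ^ 2 < 1}) *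
        S.indicator (fun _ => 1) p.2 := by
    rintro ⟨ρ, φ⟩ ⟨hρ, hφ⟩
    have h3 : (ρ * Real.cos φ) ^ 2 + (ρ * Real.sin φ) ^ 2 = ρ ^ 2 := by
      linear_combination ρ ^ 2 * Real.sin_sq_add_cos_sq φ
    have h4 := hWS ρ φ hρ hφ
    by_cases hS' : φ ∈ S
    · simp [polarCoord_symm_apply, h4.2 hS', hS', h3]
    · have h5 : (ρ * Real.cos φ, ρ * Real.sin φ) ∉ W := fun h => hS' (h4.1 h)
      simp [polarCoord_symm_apply, h5, hS']
  rw [setLIntegral_congr_fun (measurableSet_Ioi.prod measurableSet_Ioo) h2,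
    Measure.volume_eq_prod, ← Measure.prod_restrict,
    lintegral_prod_mul (f := fun ρ => ENNReal.ofReal ρ * volume {z : ℝ | z ^ 2 + ρ ^ 2 < 1})
      ((ENNReal.measurable_ofReal.mul (hg.comp (measurable_id.pow_const 2))).aemeasurable)
      ((measurable_const.indicator hS).aemeasurable)]
  congr 1
  rw [lintegral_indicator_const hS, one_mul, Measure.restrict_apply hS]

/-- The universal constant is calibrated on the whole ball: `4π / 3 = c * 2π`. -/
lemma volume_angular_sector {W : Set (ℝ × ℝ)} {S : Set ℝ} (hW : MeasurableSet W)
    (hS : MeasurableSet S)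
    (hWS : ∀ ρ φ : ℝ, 0 < ρ → φ ∈ Ioo (-Real.pi) Real.pi →
      ((ρ * Real.cos φ, ρ * Real.sin φ) ∈ W ↔ φ ∈ S)) :
    volume {v : E3 | ‖v‖ < 1 ∧ (v 0, v 1) ∈ W} =
      ENNReal.ofReal (2 / 3) * volume (S ∩ Ioo (-Real.pi) Real.pi) := by
  obtain ⟨c, hc⟩ := exists_volume_angular_sector
  have h := hc univ univ MeasurableSet.univ MeasurableSet.univ (by simp)
  have hball : {v : E3 | ‖v‖ < 1 ∧ (v 0, v 1) ∈ (univ : Set (ℝ × ℝ))} = Metric.ball 0 1 := by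
    ext; simp
  rw [hball, EuclideanSpace.volume_ball_fin_three, univ_inter, Real.volume_Ioo,
    ENNReal.ofReal_one, one_pow, one_mul] at h
  have hpi := Real.pi_pos
  have hc' : c = ENNReal.ofReal (2 / 3) := by
    have h0 : ENNReal.ofReal (Real.pi - -Real.pi) ≠ 0 := by
      simp only [ne_eq, ENNReal.ofReal_eq_zero, not_le]; linarith
    have h1 : ENNReal.ofReal (2 / 3) * ENNReal.ofReal (Real.pi - -Real.pi) =
        ENNReal.ofReal (Real.pi * 4 / 3) := by
      rw [← ENNReal.ofReal_mul (by norm_num)]; congr 1; ring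
    rw [← h1] at h
    exact ((ENNReal.mul_left_inj h0 ENNReal.ofReal_ne_top).1 h).symm
  rw [hc W S hW hS hWS, hc']

lemma cos_nonneg_and_cos_sub_nonneg_iff {θ φ : ℝ} (hθ : θ ∈ Ico 0 Real.pi)
    (hφ : φ ∈ Ioo (-Real.pi) Real.pi) :
    0 ≤ Real.cos φ ∧ 0 ≤ Real.cos (φ - θ) ↔ φ ∈ Icc (θ - Real.pi / 2) (Real.pi / 2) := by
  obtain ⟨h1, h2⟩ := hθ
  obtain ⟨h3, h4⟩ := hφ
  constructor
  · rintro ⟨hc, hd⟩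
    have h5 : φ ≤ Real.pi / 2 := by
      by_contra! h
      exact absurd (Real.cos_neg_of_pi_div_two_lt_of_lt h (by linarith)) (not_lt.2 hc)
    have h6 : -(Real.pi / 2) ≤ φ := by
      by_contra! h
      have := Real.cos_neg_of_pi_div_two_lt_of_lt (x := -φ) (by linarith) (by linarith)
      rw [Real.cos_neg] at this
      linarith
    refine ⟨?_, h5⟩
    by_contra! h
    have := Real.cos_neg_of_pi_div_two_lt_of_lt (x := θ - φ) (by linarith) (by linarith)
    rw [← Real.cos_neg, neg_sub] at this
    linarith
  · rintro ⟨h5, h6⟩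
    exact ⟨Real.cos_nonneg_of_neg_pi_div_two_le_of_le (by linarith) h6,
      Real.cos_nonneg_of_neg_pi_div_two_le_of_le (by linarith) (by linarith)⟩

/-- The volume of the part of the unit ball in the intersection of two half-spaces with normals at
angle `θ`; its dihedral angle is `π - θ`. -/
lemma volume_wedge {n₁ n₂ : E3} (h : LinearIndependent ℝ ![n₁, n₂]) :
    volume {v : E3 | ‖v‖ < 1 ∧ 0 ≤ ⟪n₁, v⟫ ∧ 0 ≤ ⟪n₂, v⟫} =
      ENNReal.ofReal (2 / 3 * (Real.pi - InnerProductGeometry.angle n₁ n₂)) := by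
  set θ := InnerProductGeometry.angle n₁ n₂ with hθ
  have hn₁ : n₁ ≠ 0 := h.ne_zero 0
  have hn₂ : n₂ ≠ 0 := h.ne_zero 1
  have hp₁ : 0 < ‖n₁‖ := norm_pos_iff.2 hn₁
  have hp₂ : 0 < ‖n₂‖ := norm_pos_iff.2 hn₂
  have hθπ : θ < Real.pi := by
    refine lt_of_le_of_ne (InnerProductGeometry.angle_le_pi _ _) fun hc => ?_
    obtain ⟨-, r, -, hr⟩ := InnerProductGeometry.angle_eq_pi_iff.1 hc
    have := LinearIndependent.pair_iff.1 h r (-1) (by simp [hr])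
    norm_num at this
  have hθ0 : 0 < θ := by
    refine lt_of_le_of_ne (InnerProductGeometry.angle_nonneg _ _) fun hc => ?_
    obtain ⟨-, r, -, hr⟩ := InnerProductGeometry.angle_eq_zero_iff.1 hc.symm
    have := LinearIndependent.pair_iff.1 h r (-1) (by simp [hr])
    norm_num at this
  have hsin : 0 < Real.sin θ := Real.sin_pos_of_pos_of_lt_pi hθ0 hθπ
  have hcos : ⟪n₁, n₂⟫ = Real.cos θ * (‖n₁‖ * ‖n₂‖) :=
    (InnerProductGeometry.cos_angle_mul_norm_mul_norm n₁ n₂).symm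
  have hsc := Real.sin_sq_add_cos_sq θ
  -- Gram–Schmidt: in a basis starting with `e₁, e₂`, the normals point in the directions `(1, 0,
  -- 0)` and `(cos θ, sin θ, 0)`, so the wedge is a condition on the polar angle alone.
  let e₁ : E3 := ‖n₁‖⁻¹ • n₁
  let e₂ : E3 := (Real.sin θ)⁻¹ • (‖n₂‖⁻¹ • n₂ - Real.cos θ • e₁)
  have h11 : ⟪e₁, e₁⟫ = 1 := by
    simp only [e₁, inner_smul_left, inner_smul_right, real_inner_self_eq_norm_sq]
    simp; field_simp
  have h1n : ⟪e₁, n₂⟫ = Real.cos θ * ‖n₂‖ := by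
    simp only [e₁, inner_smul_left, hcos]
    simp; field_simp
  have h12 : ⟪e₁, e₂⟫ = 0 := by
    simp only [e₂, inner_smul_right, inner_sub_right, h11, h1n]
    field_simp; ring
  have hn2 : ⟪n₂, n₂⟫ = ‖n₂‖ ^ 2 := real_inner_self_eq_norm_sq _
  have h22 : ⟪e₂, e₂⟫ = 1 := by
    have h21 : ⟪n₂, e₁⟫ = Real.cos θ * ‖n₂‖ := by rw [real_inner_comm, h1n]
    simp only [e₂, inner_smul_right, inner_sub_right, inner_smul_left, inner_sub_left, h11, h1n,
      h21, hn2]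
    simp only [conj_trivial]
    field_simp
    linear_combination -hsc
  have hv : Orthonormal ℝ (({0, 1} : Set (Fin 3)).domRestrict ![e₁, e₂, 0]) := by
    have hn : ∀ e : E3, ⟪e, e⟫ = 1 → ‖e‖ = 1 := fun e he => by
      rw [norm_eq_sqrt_real_inner, he, Real.sqrt_one]
    have h21 : ⟪e₂, e₁⟫ = 0 := by rw [real_inner_comm, h12]
    constructor
    · rintro ⟨i, rfl | rfl⟩
      exacts [hn _ h11, hn _ h22]
    · rintro ⟨i, rfl | rfl⟩ ⟨j, rfl | rfl⟩ hij
      exacts [(hij rfl).elim, h12, h21, (hij rfl).elim]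
  obtain ⟨b, hb⟩ := hv.exists_orthonormalBasis_extension_of_card_eq (by simp)
  have hb0 : b 0 = e₁ := hb 0 (by simp)
  have hb1 : b 1 = e₂ := hb 1 (by simp)
  have hr1 : ∀ v : E3, ⟪n₁, v⟫ = ‖n₁‖ * b.repr v 0 := by
    intro v
    rw [b.repr_apply_apply, hb0]
    simp only [e₁, inner_smul_left]
    simp; field_simp
  have hr2 : ∀ v : E3, ⟪n₂, v⟫ = ‖n₂‖ * (Real.cos θ * b.repr v 0 + Real.sin θ * b.repr v 1) := by
    intro v
    have : n₂ = ‖n₂‖ • (Real.cos θ • b 0 + Real.sin θ • b 1) := by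
      rw [hb0, hb1]
      simp only [e₂]
      rw [smul_inv_smul₀ hsin.ne', add_sub_cancel, smul_inv_smul₀ hp₂.ne']
    rw [b.repr_apply_apply, b.repr_apply_apply]
    conv_lhs => rw [this]
    simp only [inner_smul_left, inner_add_left, conj_trivial]
  have hset : {v : E3 | ‖v‖ < 1 ∧ 0 ≤ ⟪n₁, v⟫ ∧ 0 ≤ ⟪n₂, v⟫} =
      b.repr ⁻¹' {v : E3 | ‖v‖ < 1 ∧
        (v 0, v 1) ∈ {p : ℝ × ℝ | 0 ≤ p.1 ∧ 0 ≤ Real.cos θ * p.1 + Real.sin θ * p.2}} := by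
    ext v
    simp only [mem_ofPred_eq, mem_preimage, LinearIsometryEquiv.norm_map, hr1, hr2,
      mul_nonneg_iff_of_pos_left hp₁, mul_nonneg_iff_of_pos_left hp₂]
  have hW : MeasurableSet {p : ℝ × ℝ | 0 ≤ p.1 ∧ 0 ≤ Real.cos θ * p.1 + Real.sin θ * p.2} :=
    MeasurableSet.inter (s₁ := {p : ℝ × ℝ | 0 ≤ p.1})
      (s₂ := {p : ℝ × ℝ | 0 ≤ Real.cos θ * p.1 + Real.sin θ * p.2})
      (measurableSet_le (by fun_prop) (by fun_prop))
      (measurableSet_le (by fun_prop) (by fun_prop))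
  rw [hset, b.measurePreserving_repr.measure_preimage_emb
    b.repr.toHomeomorph.measurableEmbedding,
    volume_angular_sector hW (S := Icc (θ - Real.pi / 2) (Real.pi / 2)) measurableSet_Icc]
  · have hsub : Icc (θ - Real.pi / 2) (Real.pi / 2) ⊆ Ioo (-Real.pi) Real.pi :=
      Icc_subset_Ioo (by linarith) (by linarith)
    rw [inter_eq_left.2 hsub, Real.volume_Icc, ← ENNReal.ofReal_mul (by norm_num)]
    congr 1; ring
  · intro ρ φ hρ hφ
    rw [← cos_nonneg_and_cos_sub_nonneg_iff ⟨hθ0.le, hθπ⟩ hφ, Real.cos_sub]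
    have h3 : Real.cos θ * (ρ * Real.cos φ) + Real.sin θ * (ρ * Real.sin φ) =
        ρ * (Real.cos φ * Real.cos θ + Real.sin φ * Real.sin θ) := by ring
    simp only [mem_ofPred_eq, h3, mul_nonneg_iff_of_pos_left hρ]

/-! ### Girard's theorem by inclusion–exclusion -/

lemma measurePreserving_neg_restrict_ball :
    MeasurePreserving (Neg.neg : E3 → E3) (volume.restrict (Metric.ball 0 1))
      (volume.restrict (Metric.ball 0 1)) := by
  have h := (Measure.measurePreserving_neg (volume : Measure E3)).restrict_preimage
    (s := Metric.ball 0 1) measurableSet_ball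
  have h2 : (Neg.neg : E3 → E3) ⁻¹' Metric.ball 0 1 = Metric.ball 0 1 := by ext; simp
  rwa [h2] at h

lemma volume_hyperplane {n : E3} (hn : n ≠ 0) : volume {v : E3 | ⟪n, v⟫ = 0} = 0 := by
  have h : {v : E3 | ⟪n, v⟫ = 0} = ((Submodule.span ℝ {n})ᗮ : Submodule ℝ E3) := by
    ext v; simp [Submodule.mem_orthogonal_singleton_iff_inner_right]
  rw [h]
  refine Measure.addHaar_submodule _ _ fun h => hn ?_
  have h2 : n ∈ (Submodule.span ℝ {n})ᗮ := h ▸ Submodule.mem_top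
  rw [Submodule.mem_orthogonal_singleton_iff_inner_right] at h2
  exact inner_self_eq_zero.1 h2

/-- The complement of a closed half-space is the antipode of an open one; since the two differ by a
null plane, the complement can be compared with the closed half-space itself. -/
lemma closed_halfspace_ae_eq_open {n : E3} (hn : n ≠ 0) :
    {v : E3 | 0 ≤ ⟪n, v⟫} =ᵐ[volume.restrict (Metric.ball 0 1)] {v : E3 | 0 < ⟪n, v⟫} := by
  have h : ∀ᵐ v ∂(volume.restrict (Metric.ball (0 : E3) 1)), ⟪n, v⟫ ≠ 0 :=
    ae_restrict_of_ae (by rw [ae_iff]; simpa using volume_hyperplane hn)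
  filter_upwards [h] with v hv
  exact propext ⟨fun h0 : 0 ≤ ⟪n, v⟫ => lt_of_le_of_ne h0 hv.symm, fun h0 : 0 < ⟪n, v⟫ => h0.le⟩

lemma measurableSet_halfspace (n : E3) : MeasurableSet {v : E3 | 0 ≤ ⟪n, v⟫} :=
  measurableSet_le (by fun_prop) (by fun_prop)

/-- **Girard's theorem** for the cone cut out by three half-spaces. -/
lemma volume_trihedral_cone {n₁ n₂ n₃ : E3} (h₁₂ : LinearIndependent ℝ ![n₁, n₂])
    (h₁₃ : LinearIndependent ℝ ![n₁, n₃]) (h₂₃ : LinearIndependent ℝ ![n₂, n₃]) :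
    3 * (volume : Measure E3).real {v | ‖v‖ < 1 ∧ 0 ≤ ⟪n₁, v⟫ ∧ 0 ≤ ⟪n₂, v⟫ ∧ 0 ≤ ⟪n₃, v⟫} =
      2 * Real.pi - (InnerProductGeometry.angle n₁ n₂ + InnerProductGeometry.angle n₁ n₃ +
        InnerProductGeometry.angle n₂ n₃) := by
  set ν : Measure E3 := volume.restrict (Metric.ball 0 1) with hν
  have : IsFiniteMeasure ν := ⟨by
    rw [hν, Measure.restrict_apply_univ]; exact measure_ball_lt_top⟩
  let H : E3 → Set E3 := fun n => {v | 0 ≤ ⟪n, v⟫}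
  let G : E3 → Set E3 := fun n => {v | 0 < ⟪n, v⟫}
  have hH : ∀ n, MeasurableSet (H n) := measurableSet_halfspace
  have hae : ∀ {n}, n ≠ 0 → H n =ᵐ[ν] G n := closed_halfspace_ae_eq_open
  have hcompl : ∀ n, (H n)ᶜ = Neg.neg ⁻¹' G n := by
    intro n; ext v; simp [H, G]
  have hG : ∀ n, MeasurableSet (G n) := fun n => measurableSet_lt (by fun_prop) (by fun_prop)
  have hneg : ∀ s, MeasurableSet s → ν.real (Neg.neg ⁻¹' s) = ν.real s := fun s hs =>
    measurePreserving_neg_restrict_ball.measureReal_preimage hs.nullMeasurableSet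
  have htot : ν.real univ = 4 / 3 * Real.pi := by
    have hpi := Real.pi_pos
    rw [hν, measureReal_restrict_apply_univ, measureReal_def,
      EuclideanSpace.volume_ball_fin_three, ENNReal.ofReal_one, one_pow, one_mul,
      ENNReal.toReal_ofReal (by positivity)]
    ring
  have hhalf : ∀ {n}, n ≠ 0 → ν.real (H n) = 2 / 3 * Real.pi := by
    intro n hn
    have h := measureReal_add_measureReal_compl (μ := ν) (hH n)
    rw [hcompl, hneg _ (hG n), ← measureReal_congr (hae hn), htot] at h
    linarith
  have hwedge : ∀ {m n}, LinearIndependent ℝ ![m, n] →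
      ν.real (H m ∩ H n) = 2 / 3 * (Real.pi - InnerProductGeometry.angle m n) := by
    intro m n h
    have hs : H m ∩ H n ∩ Metric.ball 0 1 = {v : E3 | ‖v‖ < 1 ∧ 0 ≤ ⟪m, v⟫ ∧ 0 ≤ ⟪n, v⟫} := by
      ext v; simp [H]; tauto
    rw [hν, measureReal_restrict_apply ((hH m).inter (hH n)), hs, measureReal_def,
      volume_wedge h, ENNReal.toReal_ofReal]
    have := InnerProductGeometry.angle_le_pi m n
    linarith
  have hT : ν.real (H n₁ ∩ H n₂ ∩ H n₃) =
      (volume : Measure E3).real {v | ‖v‖ < 1 ∧ 0 ≤ ⟪n₁, v⟫ ∧ 0 ≤ ⟪n₂, v⟫ ∧ 0 ≤ ⟪n₃, v⟫} := by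
    rw [hν, measureReal_restrict_apply (((hH _).inter (hH _)).inter (hH _))]
    congr 1
    ext v; simp [H]; tauto
  have hn₁ : n₁ ≠ 0 := h₁₂.ne_zero 0
  have hn₂ : n₂ ≠ 0 := h₁₂.ne_zero 1
  have hn₃ : n₃ ≠ 0 := h₁₃.ne_zero 1
  -- Inclusion–exclusion for the union of the three half-spaces. Its complement is, up to a null
  -- set, the antipode of the triple intersection, so the unknown volume occurs twice with the same
  -- sign and can be solved for.
  have e1 := measureReal_union_add_inter (μ := ν) (s := H n₁) (hH n₂)
  have e2 := measureReal_union_add_inter (μ := ν) (s := H n₁ ∪ H n₂) (hH n₃)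
  have e3 := measureReal_union_add_inter (μ := ν) (s := H n₁ ∩ H n₃) ((hH n₂).inter (hH n₃))
  have e4 := measureReal_add_measureReal_compl (μ := ν) (((hH n₁).union (hH n₂)).union (hH n₃))
  rw [← inter_inter_distrib_right] at e3
  rw [union_inter_distrib_right] at e2
  rw [compl_union, compl_union, hcompl, hcompl, hcompl, ← preimage_inter, ← preimage_inter,
    hneg _ (((hG _).inter (hG _)).inter (hG _)),
    ← measureReal_congr (((hae hn₁).inter (hae hn₂)).inter (hae hn₃)), htot] at e4
  rw [hhalf hn₁, hhalf hn₂, hwedge h₁₂] at e1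
  rw [hhalf hn₃] at e2
  rw [hwedge h₁₃, hwedge h₂₃] at e3
  rw [← hT]
  linarith

/-! ### The area of a spherical triangle with sides at most `π / 3` -/

/-- The solid angle of the regular Euclidean tetrahedron. -/
lemma regular_solid_angle_mem : 3 * Real.arccos (1 / 3) - Real.pi ∈ Icc 0 Real.pi := by
  have hpi := Real.pi_pos
  have h1 : Real.arccos (1 / 3) ≤ Real.pi / 2 := Real.arccos_le_pi_div_two.2 (by norm_num)
  have h2 : Real.pi / 3 ≤ Real.arccos (1 / 3) := by
    rw [← Real.arccos_cos (x := Real.pi / 3) (by linarith) (by linarith), Real.cos_pi_div_three]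
    exact Real.arccos_le_arccos (by norm_num)
  constructor <;> linarith

lemma cos_regular_solid_angle : Real.cos (3 * Real.arccos (1 / 3) - Real.pi) = 23 / 27 := by
  rw [Real.cos_sub_pi, Real.cos_three_mul, Real.cos_arccos (by norm_num) (by norm_num)]
  norm_num

/-- Three unit vectors at mutual angles at most `π / 3` span a parallelepiped of small volume
compared with the regular case; the left side involves
their Gram determinant. -/
lemma gram_det_le {A B C : ℝ} (hA : 1 / 2 ≤ A) (hA' : A ≤ 1) (hB : 1 / 2 ≤ B) (hB' : B ≤ 1)
    (hC : 1 / 2 ≤ C) (hC' : C ≤ 1) :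
    25 * (1 + 2 * A * B * C - A ^ 2 - B ^ 2 - C ^ 2) ≤ 2 * (1 + A + B + C) ^ 2 := by
  obtain ⟨a, rfl⟩ : ∃ a, A = 1 / 2 + a := ⟨A - 1 / 2, by ring⟩
  obtain ⟨b, rfl⟩ : ∃ b, B = 1 / 2 + b := ⟨B - 1 / 2, by ring⟩
  -- Equality holds at `A = B = C = 1 / 2`, so the expansion is made there. The quadratic part is
  -- handled by squares; the cubic term `a * b * c` is absorbed by the linear one, using `b * c ≤ 1
  -- / 4`.
  obtain ⟨c, rfl⟩ : ∃ c, C = 1 / 2 + c := ⟨C - 1 / 2, by ring⟩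
  have ha : 0 ≤ a := by linarith
  have hb : 0 ≤ b := by linarith
  have hc : 0 ≤ c := by linarith
  have hbc : b * c ≤ 1 / 4 := by
    calc b * c ≤ 1 / 2 * (1 / 2) := by gcongr <;> linarith
      _ = 1 / 4 := by norm_num
  have h : a * (b * c) ≤ a * (1 / 4) := by gcongr
  nlinarith [sq_nonneg (a - b), sq_nonneg (b - c), sq_nonneg (c - a), sq_nonneg (a + b + c)]

/-- The area bound for a spherical triangle whose sides have cosines `A`, `B`, `C`, in terms of the
exterior angles `θ`. -/
lemma spherical_excess_le {A B C d a b c θ₁ θ₂ θ₃ : ℝ} (hA : 1 / 2 ≤ A) (hB : 1 / 2 ≤ B)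
    (hC : 1 / 2 ≤ C) (ha : 0 < a) (hb : 0 < b) (hc : 0 < c) (ha2 : a ^ 2 = 1 - A ^ 2)
    (hb2 : b ^ 2 = 1 - B ^ 2) (hc2 : c ^ 2 = 1 - C ^ 2) (hd : 0 < d)
    (hd2 : d ^ 2 = 1 + 2 * A * B * C - A ^ 2 - B ^ 2 - C ^ 2)
    (hc₁ : Real.cos θ₁ = (B * C - A) / (b * c)) (hs₁ : Real.sin θ₁ = d / (b * c))
    (hc₂ : Real.cos θ₂ = (C * A - B) / (c * a)) (hs₂ : Real.sin θ₂ = d / (c * a))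
    (hc₃ : Real.cos θ₃ = (A * B - C) / (a * b)) (hs₃ : Real.sin θ₃ = d / (a * b))
    (hE0 : 0 ≤ 2 * Real.pi - (θ₁ + θ₂ + θ₃)) (hE1 : 0 < θ₁ + θ₂ + θ₃) :
    2 * Real.pi - (θ₁ + θ₂ + θ₃) ≤ 3 * Real.arccos (1 / 3) - Real.pi := by
  have hA1 : A < 1 := by nlinarith [sq_pos_of_pos ha]
  have hB1 : B < 1 := by nlinarith [sq_pos_of_pos hb]
  have hC1 : C < 1 := by nlinarith [sq_pos_of_pos hc]
  have hg := gram_det_le hA hA1.le hB hB1.le hC hC1.le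
  rw [← hd2] at hg
  have hM : 0 < (1 - A) * (1 - B) * (1 - C) :=
    mul_pos (mul_pos (by linarith) (by linarith)) (by linarith)
  have hN : 0 < (1 + A) * (1 + B) * (1 + C) := by positivity
  have hMN : (a * b * c) ^ 2 =
      ((1 - A) * (1 - B) * (1 - C)) * ((1 + A) * (1 + B) * (1 + C)) := by
    rw [mul_pow, mul_pow, ha2, hb2, hc2]; ring
  have hcos : Real.cos (θ₁ + θ₂ + θ₃) =
      ((1 + A + B + C) ^ 2 - d ^ 2) / (2 * ((1 + A) * (1 + B) * (1 + C))) := by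
    have h1 : Real.cos (θ₁ + θ₂ + θ₃) = ((B * C - A) * (C * A - B) * (A * B - C) -
        d ^ 2 * ((B * C - A) + (C * A - B) + (A * B - C))) / (a * b * c) ^ 2 := by
      rw [Real.cos_add, Real.cos_add, Real.sin_add, hc₁, hc₂, hc₃, hs₁, hs₂, hs₃]
      field_simp
      ring
    rw [h1, hMN, hd2, div_eq_div_iff (by positivity) (by positivity)]
    ring
  have hsin : Real.sin (θ₁ + θ₂ + θ₃) =
      -((1 + A + B + C) * d / ((1 + A) * (1 + B) * (1 + C))) := by
    have h1 : Real.sin (θ₁ + θ₂ + θ₃) = d * ((B * C - A) * (C * A - B) +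
        (C * A - B) * (A * B - C) + (A * B - C) * (B * C - A) - d ^ 2) / (a * b * c) ^ 2 := by
      rw [Real.sin_add, Real.cos_add, Real.sin_add, hc₁, hc₂, hc₃, hs₁, hs₂, hs₃]
      field_simp
      ring
    rw [h1, hMN, hd2, ← neg_div, div_eq_div_iff (by positivity) (by positivity)]
    ring
  set E := 2 * Real.pi - (θ₁ + θ₂ + θ₃) with hE
  -- Since `(1 + A + B + C) ^ 2 + d ^ 2 = 2 (1 + A) (1 + B) (1 + C)`, this is equivalent to the Gram
  -- bound `25 d ^ 2 ≤ 2 (1 + A + B + C) ^ 2`.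
  have hcosE : 23 / 27 ≤ Real.cos E := by
    rw [hE, Real.cos_two_pi_sub, hcos, div_le_div_iff₀ (by norm_num) (by positivity)]
    nlinarith
  have hsinE : 0 < Real.sin E := by
    rw [hE, Real.sin_two_pi_sub, hsin, neg_neg]
    positivity
  -- `E` lies in `[0, 2π)` with positive sine, which places it where cosine is injective and
  -- decreasing.
  have hEpi : E ≤ Real.pi := by
    by_contra! h
    have h2 := Real.sin_pos_of_pos_of_lt_pi (x := E - Real.pi) (by linarith) (by linarith)
    rw [Real.sin_sub_pi] at h2
    linarith
  rw [← Real.strictAntiOn_cos.le_iff_ge regular_solid_angle_mem ⟨hE0, hEpi⟩,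
    cos_regular_solid_angle]
  exact hcosE

/-! ### From trihedral cones in the ball to areas on the sphere -/

/-- The area on the unit sphere cut out by a cone is at most three times the volume of the part of
the cone in the unit ball. -/
lemma toSphere_real_preimage_le {T : Set E3} (hT : MeasurableSet T)
    (hcone : ∀ t : ℝ, 0 < t → ∀ v ∈ T, t • v ∈ T) :
    (volume : Measure E3).toSphere.real {u | (u : E3) ∈ T} ≤
      3 * (volume : Measure E3).real {v | ‖v‖ < 1 ∧ v ∈ T} := by
  have hm : MeasurableSet {u : Metric.sphere (0 : E3) 1 | (u : E3) ∈ T} := measurable_subtype_coe hT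
  have hfin : (volume : Measure E3) {v | ‖v‖ < 1 ∧ v ∈ T} ≠ ∞ := by
    refine ne_top_of_le_ne_top (measure_ball_lt_top (x := (0 : E3)) (r := 1)).ne
      (measure_mono fun v hv => ?_)
    simpa using hv.1
  rw [measureReal_def, Measure.toSphere_apply' _ hm, ENNReal.toReal_mul]
  simp only [finrank_euclideanSpace, Fintype.card_fin, Nat.cast_ofNat]
  refine mul_le_mul_of_nonneg_left (ENNReal.toReal_mono hfin (measure_mono ?_)) (by norm_num)
  rintro _ ⟨t, ht, _, ⟨u, hu, rfl⟩, rfl⟩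
  refine ⟨?_, hcone t ht.1 _ hu⟩
  have : ‖(u : E3)‖ = 1 := by simp
  simp only [norm_smul, this, mul_one, Real.norm_eq_abs, abs_of_pos ht.1]
  exact ht.2

lemma toSphere_real_submodule {p : Submodule ℝ E3} (hp : p ≠ ⊤) :
    (volume : Measure E3).toSphere.real {u | (u : E3) ∈ p} = 0 := by
  have h := toSphere_real_preimage_le (T := (p : Set E3)) p.closed_of_finiteDimensional.measurableSet
    fun t _ v hv => p.smul_mem t hv
  have h0 : (volume : Measure E3).real {v | ‖v‖ < 1 ∧ v ∈ (p : Set E3)} = 0 := by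
    rw [measureReal_def, measure_mono_null (fun v hv => hv.2) (Measure.addHaar_submodule _ p hp)]
    rfl
  rw [h0, mul_zero] at h
  exact le_antisymm h measureReal_nonneg

lemma linearIndependent_pair_of_inner {m n : E3}
    (h : 0 < ⟪m, m⟫ * ⟪n, n⟫ - ⟪m, n⟫ ^ 2) : LinearIndependent ℝ ![m, n] := by
  rw [LinearIndependent.pair_iff]
  intro s t hst
  have h1 : s * ⟪m, m⟫ + t * ⟪m, n⟫ = 0 := by
    have := congrArg (fun v => ⟪m, v⟫) hst
    simpa only [inner_add_right, inner_smul_right, inner_zero_right] using this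
  have h2 : s * ⟪m, n⟫ + t * ⟪n, n⟫ = 0 := by
    have := congrArg (fun v => ⟪n, v⟫) hst
    simpa only [inner_add_right, inner_smul_right, inner_zero_right, real_inner_comm m n]
      using this
  constructor
  · refine (mul_eq_zero.1 (?_ : s * (⟪m, m⟫ * ⟪n, n⟫ - ⟪m, n⟫ ^ 2) = 0)).resolve_right h.ne'
    linear_combination ⟪n, n⟫ * h1 - ⟪m, n⟫ * h2
  · refine (mul_eq_zero.1 (?_ : t * (⟪m, m⟫ * ⟪n, n⟫ - ⟪m, n⟫ ^ 2) = 0)).resolve_right h.ne'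
    linear_combination ⟪m, m⟫ * h2 - ⟪m, n⟫ * h1

/-- A spherical triangle with sides at most `π / 3` has at most the area of the equilateral
triangle with side `π / 3`. -/
theorem toSphere_real_cone_le {x₁ x₂ x₃ : E3} (h₁ : ‖x₁‖ = 1) (h₂ : ‖x₂‖ = 1) (h₃ : ‖x₃‖ = 1)
    (h₂₃ : 1 / 2 ≤ ⟪x₂, x₃⟫) (h₃₁ : 1 / 2 ≤ ⟪x₃, x₁⟫) (h₁₂ : 1 / 2 ≤ ⟪x₁, x₂⟫) :
    (volume : Measure E3).toSphere.real
      {u | ∃ c : Fin 3 → ℝ, (∀ i, 0 ≤ c i) ∧ (u : E3) = c 0 • x₁ + c 1 • x₂ + c 2 • x₃} ≤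
      3 * Real.arccos (1 / 3) - Real.pi := by
  -- If the three directions do not span, the cone lies in a proper subspace and has area zero.
  by_cases hspan : Submodule.span ℝ (range ![x₁, x₂, x₃]) = ⊤
  swap
  · refine le_trans (measureReal_mono ?_) ((toSphere_real_submodule hspan).trans_le
      regular_solid_angle_mem.1)
    rintro u ⟨c, -, hu⟩
    have hx : ∀ i, ![x₁, x₂, x₃] i ∈ Submodule.span ℝ (range ![x₁, x₂, x₃]) := fun i =>
      Submodule.subset_span (mem_range_self i)
    rw [mem_ofPred_eq, hu]
    exact add_mem (add_mem (Submodule.smul_mem _ _ (hx 0)) (Submodule.smul_mem _ _ (hx 1)))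
      (Submodule.smul_mem _ _ (hx 2))
  have hrep : ∀ v : E3, ∃ c : Fin 3 → ℝ, v = c 0 • x₁ + c 1 • x₂ + c 2 • x₃ := by
    intro v
    have hv : v ∈ Submodule.span ℝ (range ![x₁, x₂, x₃]) := hspan ▸ Submodule.mem_top
    obtain ⟨c, hc⟩ := (Submodule.mem_span_range_iff_exists_fun ℝ).1 hv
    exact ⟨c, by rw [← hc, Fin.sum_univ_three]; rfl⟩
  have hLI : LinearIndependent ℝ ![x₁, x₂, x₃] :=
    linearIndependent_of_top_le_span_of_card_eq_finrank hspan.ge (by simp)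
  obtain ⟨A, hA⟩ : ∃ A, A = ⟪x₂, x₃⟫ := ⟨_, rfl⟩
  obtain ⟨B, hB⟩ : ∃ B, B = ⟪x₃, x₁⟫ := ⟨_, rfl⟩
  obtain ⟨C, hC⟩ : ∃ C, C = ⟪x₁, x₂⟫ := ⟨_, rfl⟩
  rw [← hA] at h₂₃; rw [← hB] at h₃₁; rw [← hC] at h₁₂
  have i11 : ⟪x₁, x₁⟫ = 1 := by rw [real_inner_self_eq_norm_sq, h₁, one_pow]
  have i22 : ⟪x₂, x₂⟫ = 1 := by rw [real_inner_self_eq_norm_sq, h₂, one_pow]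
  have i33 : ⟪x₃, x₃⟫ = 1 := by rw [real_inner_self_eq_norm_sq, h₃, one_pow]
  have i32 : ⟪x₃, x₂⟫ = A := by rw [hA, real_inner_comm]
  have i13 : ⟪x₁, x₃⟫ = B := by rw [hB, real_inner_comm]
  have i21 : ⟪x₂, x₁⟫ = C := by rw [hC, real_inner_comm]
  have hlt : ∀ {x y : E3}, ‖x‖ = 1 → ‖y‖ = 1 → x ≠ y → ⟪x, y⟫ < 1 := fun hx hy hxy =>
    (inner_lt_one_iff_real_of_norm_eq_one hx hy).2 hxy
  have hinj := hLI.injective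
  have hA1 : A < 1 := hA ▸ hlt h₂ h₃ fun h => absurd (@hinj 1 2 h) (by decide)
  have hB1 : B < 1 := hB ▸ hlt h₃ h₁ fun h => absurd (@hinj 2 0 h) (by decide)
  have hC1 : C < 1 := hC ▸ hlt h₁ h₂ fun h => absurd (@hinj 0 1 h) (by decide)
  obtain ⟨D, hD⟩ : ∃ D, D = 1 + 2 * A * B * C - A ^ 2 - B ^ 2 - C ^ 2 := ⟨_, rfl⟩
  -- The coefficients are the rows of the adjugate of the Gram matrix of the `x`'s, so the `n`'s are
  -- `D` times the dual basis: inward normals to the faces of the cone.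
  obtain ⟨n₁, hn₁⟩ : ∃ n, n = (1 - A ^ 2) • x₁ + (A * B - C) • x₂ + (C * A - B) • x₃ := ⟨_, rfl⟩
  obtain ⟨n₂, hn₂⟩ : ∃ n, n = (A * B - C) • x₁ + (1 - B ^ 2) • x₂ + (B * C - A) • x₃ := ⟨_, rfl⟩
  obtain ⟨n₃, hn₃⟩ : ∃ n, n = (C * A - B) • x₁ + (B * C - A) • x₂ + (1 - C ^ 2) • x₃ := ⟨_, rfl⟩
  have hn1 : ∀ c : Fin 3 → ℝ, ⟪n₁, c 0 • x₁ + c 1 • x₂ + c 2 • x₃⟫ = c 0 * D := by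
    intro c
    rw [hn₁]
    simp only [inner_add_left, inner_add_right, inner_smul_left, inner_smul_right, i11, i22, i33,
      i32, i13, i21, ← hA, ← hB, ← hC, conj_trivial, hD]
    ring
  have hn2 : ∀ c : Fin 3 → ℝ, ⟪n₂, c 0 • x₁ + c 1 • x₂ + c 2 • x₃⟫ = c 1 * D := by
    intro c
    rw [hn₂]
    simp only [inner_add_left, inner_add_right, inner_smul_left, inner_smul_right, i11, i22, i33,
      i32, i13, i21, ← hA, ← hB, ← hC, conj_trivial, hD]
    ring
  have hn3 : ∀ c : Fin 3 → ℝ, ⟪n₃, c 0 • x₁ + c 1 • x₂ + c 2 • x₃⟫ = c 2 * D := by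
    intro c
    rw [hn₃]
    simp only [inner_add_left, inner_add_right, inner_smul_left, inner_smul_right, i11, i22, i33,
      i32, i13, i21, ← hA, ← hB, ← hC, conj_trivial, hD]
    ring
  -- Each normal is itself a combination of the `x`'s, so pairing with another normal reads off a
  -- coefficient times `D`: the Gram matrix of the normals is `D` times the adjugate.
  have n11 : ⟪n₁, n₁⟫ = (1 - A ^ 2) * D := by
    rw [← show ![1 - A ^ 2, A * B - C, C * A - B] 0 = 1 - A ^ 2 from rfl, ← hn1]
    exact congrArg _ hn₁
  have n22 : ⟪n₂, n₂⟫ = (1 - B ^ 2) * D := by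
    rw [← show ![A * B - C, 1 - B ^ 2, B * C - A] 1 = 1 - B ^ 2 from rfl, ← hn2]
    exact congrArg _ hn₂
  have n33 : ⟪n₃, n₃⟫ = (1 - C ^ 2) * D := by
    rw [← show ![C * A - B, B * C - A, 1 - C ^ 2] 2 = 1 - C ^ 2 from rfl, ← hn3]
    exact congrArg _ hn₃
  have n12 : ⟪n₁, n₂⟫ = (A * B - C) * D := by
    rw [← show ![A * B - C, 1 - B ^ 2, B * C - A] 0 = A * B - C from rfl, ← hn1]
    exact congrArg _ hn₂
  have n13 : ⟪n₁, n₃⟫ = (C * A - B) * D := by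
    rw [← show ![C * A - B, B * C - A, 1 - C ^ 2] 0 = C * A - B from rfl, ← hn1]
    exact congrArg _ hn₃
  have n23 : ⟪n₂, n₃⟫ = (B * C - A) * D := by
    rw [← show ![C * A - B, B * C - A, 1 - C ^ 2] 1 = B * C - A from rfl, ← hn2]
    exact congrArg _ hn₃
  have hA2 : 0 < 1 - A ^ 2 := by nlinarith
  have hB2 : 0 < 1 - B ^ 2 := by nlinarith
  have hC2 : 0 < 1 - C ^ 2 := by nlinarith
  have hn₁0 : n₁ ≠ 0 := by
    intro h
    have h0 := Fintype.linearIndependent_iff.1 hLI ![1 - A ^ 2, A * B - C, C * A - B]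
      (by rw [Fin.sum_univ_three]; exact hn₁.symm.trans h) 0
    exact hA2.ne' h0
  have hDpos : 0 < D := by
    have : 0 < ⟪n₁, n₁⟫ := real_inner_self_pos.2 hn₁0
    rw [n11] at this
    exact (mul_pos_iff_of_pos_left hA2).1 this
  obtain ⟨a, ha, ha2⟩ : ∃ a : ℝ, 0 < a ∧ a ^ 2 = 1 - A ^ 2 :=
    ⟨√(1 - A ^ 2), Real.sqrt_pos.2 hA2, Real.sq_sqrt hA2.le⟩
  obtain ⟨b, hb, hb2⟩ : ∃ b : ℝ, 0 < b ∧ b ^ 2 = 1 - B ^ 2 :=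
    ⟨√(1 - B ^ 2), Real.sqrt_pos.2 hB2, Real.sq_sqrt hB2.le⟩
  obtain ⟨c, hc, hc2⟩ : ∃ c : ℝ, 0 < c ∧ c ^ 2 = 1 - C ^ 2 :=
    ⟨√(1 - C ^ 2), Real.sqrt_pos.2 hC2, Real.sq_sqrt hC2.le⟩
  obtain ⟨d, hd, hd2⟩ : ∃ d : ℝ, 0 < d ∧ d ^ 2 = D :=
    ⟨√D, Real.sqrt_pos.2 hDpos, Real.sq_sqrt hDpos.le⟩
  have hnorm : ∀ {n : E3} {e X : ℝ}, 0 < e → e ^ 2 = X → ⟪n, n⟫ = X * D → ‖n‖ = e * d := by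
    intro n e X he he2 hn
    rw [norm_eq_sqrt_real_inner, hn, ← he2, ← hd2, ← mul_pow, Real.sqrt_sq (by positivity)]
  have N1 : ‖n₁‖ = a * d := hnorm ha ha2 n11
  have N2 : ‖n₂‖ = b * d := hnorm hb hb2 n22
  have N3 : ‖n₃‖ = c * d := hnorm hc hc2 n33
  have hangle : ∀ {m n : E3} {e f P : ℝ}, 0 < e → 0 < f → ‖m‖ = e * d → ‖n‖ = f * d →
      ⟪m, n⟫ = P * D → e ^ 2 * f ^ 2 - P ^ 2 = D →
      Real.cos (InnerProductGeometry.angle m n) = P / (e * f) ∧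
      Real.sin (InnerProductGeometry.angle m n) = d / (e * f) ∧
      LinearIndependent ℝ ![m, n] := by
    intro m n e f P he hf hm hn hmn hP
    have hm0 : m ≠ 0 := by rw [← norm_pos_iff, hm]; positivity
    have hn0 : n ≠ 0 := by rw [← norm_pos_iff, hn]; positivity
    have hq : ⟪m, m⟫ * ⟪n, n⟫ - ⟪m, n⟫ * ⟪m, n⟫ = (d ^ 3) ^ 2 := by
      rw [real_inner_self_eq_norm_sq, real_inner_self_eq_norm_sq, hm, hn, hmn, ← hd2]
      rw [← hd2] at hP
      linear_combination d ^ 4 * hP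
    refine ⟨?_, ?_, linearIndependent_pair_of_inner ?_⟩
    · rw [InnerProductGeometry.cos_angle, hm, hn, hmn, ← hd2]
      field_simp
    · rw [InnerProductGeometry.sin_angle hm0 hn0, hq, Real.sqrt_sq (by positivity), hm, hn]
      field_simp
    · rw [sq ⟪m, n⟫, hq]; positivity
  obtain ⟨c23, s23, l23⟩ := hangle hb hc N2 N3 n23 (by rw [hb2, hc2, hD]; ring)
  obtain ⟨c13, s13, l13⟩ := hangle ha hc N1 N3 n13 (by rw [ha2, hc2, hD]; ring)
  obtain ⟨c12, s12, l12⟩ := hangle ha hb N1 N2 n12 (by rw [ha2, hb2, hD]; ring)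
  have hvol := volume_trihedral_cone l12 l13 l23
  set T : Set E3 := {v | 0 ≤ ⟪n₁, v⟫ ∧ 0 ≤ ⟪n₂, v⟫ ∧ 0 ≤ ⟪n₃, v⟫} with hT
  have hTm : MeasurableSet T := (measurableSet_halfspace n₁).inter
    ((measurableSet_halfspace n₂).inter (measurableSet_halfspace n₃))
  have hTc : ∀ t : ℝ, 0 < t → ∀ v ∈ T, t • v ∈ T := by
    rintro t ht v ⟨hv1, hv2, hv3⟩
    refine ⟨?_, ?_, ?_⟩ <;> rw [inner_smul_right] <;> positivity
  refine (measureReal_mono ?_).trans ((toSphere_real_preimage_le hTm hTc).trans ?_)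
  · rintro u ⟨k, hk, hu⟩
    have k0 := mul_nonneg (hk 0) hDpos.le
    have k1 := mul_nonneg (hk 1) hDpos.le
    have k2 := mul_nonneg (hk 2) hDpos.le
    rw [← hn1] at k0; rw [← hn2] at k1; rw [← hn3] at k2
    rw [← hu] at k0 k1 k2
    exact ⟨k0, k1, k2⟩
  · have hvol' : 3 * (volume : Measure E3).real {v | ‖v‖ < 1 ∧ v ∈ T} = 2 * Real.pi -
        (InnerProductGeometry.angle n₂ n₃ + InnerProductGeometry.angle n₁ n₃ +
          InnerProductGeometry.angle n₁ n₂) := by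
      refine Eq.trans hvol ?_
      ring
    have hpos : 0 < Real.sin (InnerProductGeometry.angle n₁ n₂) := by rw [s12]; positivity
    have hangle0 : 0 < InnerProductGeometry.angle n₁ n₂ := by
      refine lt_of_le_of_ne (InnerProductGeometry.angle_nonneg _ _) fun h => ?_
      rw [← h, Real.sin_zero] at hpos
      exact hpos.false
    rw [hvol']
    refine spherical_excess_le h₂₃ h₃₁ h₁₂ ha hb hc ha2 hb2 hc2 hd (hd2.trans hD) c23 s23
      (c13.trans (by rw [mul_comm a c])) (s13.trans (by rw [mul_comm a c])) c12 s12 ?_ ?_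
    · rw [← hvol']; positivity
    · have e1 := InnerProductGeometry.angle_nonneg n₂ n₃
      have e2 := InnerProductGeometry.angle_nonneg n₁ n₃
      linarith

/-- A trihedral cone with face angles at most `π / 3` has at most the solid angle of the regular
Euclidean tetrahedron. -/
lemma coneSolidAngle_le {V : Type*} {s : Finset V} {x : V → E3} (hs : s.card = 3)
    (hx : ∀ j ∈ s, x j ≠ 0)
    (hxx : ∀ j ∈ s, ∀ k ∈ s, j ≠ k → ‖x j‖ * ‖x k‖ ≤ 2 * ⟪x j, x k⟫) :
    coneSolidAngle s x ≤ 3 * Real.arccos (1 / 3) - Real.pi := by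
  classical
  obtain ⟨j, k, l, hjk, hjl, hkl, rfl⟩ := Finset.card_eq_three.1 hs
  have hj : j ∈ ({j, k, l} : Finset V) := by simp
  have hk : k ∈ ({j, k, l} : Finset V) := by simp
  have hl : l ∈ ({j, k, l} : Finset V) := by simp
  have hunit : ∀ m ∈ ({j, k, l} : Finset V), ‖‖x m‖⁻¹ • x m‖ = 1 := fun m hm =>
    norm_smul_inv_norm (𝕜 := ℝ) (hx m hm)
  have hin : ∀ m ∈ ({j, k, l} : Finset V), ∀ n ∈ ({j, k, l} : Finset V), m ≠ n →
      1 / 2 ≤ ⟪‖x m‖⁻¹ • x m, ‖x n‖⁻¹ • x n⟫ := by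
    intro m hm n hn hmn
    have h1 := norm_pos_iff.2 (hx m hm)
    have h2 := norm_pos_iff.2 (hx n hn)
    have h3 : ⟪‖x m‖⁻¹ • x m, ‖x n‖⁻¹ • x n⟫ = ⟪x m, x n⟫ / (‖x m‖ * ‖x n‖) := by
      rw [real_inner_smul_left, real_inner_smul_right]
      field_simp
    rw [h3, div_le_div_iff₀ (by norm_num) (by positivity)]
    linarith [hxx m hm n hn hmn]
  refine (measureReal_mono ?_).trans (toSphere_real_cone_le (hunit j hj) (hunit k hk) (hunit l hl)
    (hin k hk l hl hkl) (hin l hl j hj hjl.symm) (hin j hj k hk hjk))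
  rintro u ⟨c, hc, hu⟩
  refine ⟨![c j * ‖x j‖, c k * ‖x k‖, c l * ‖x l‖], ?_, ?_⟩
  · intro m
    fin_cases m
    exacts [mul_nonneg (hc j hj) (norm_nonneg _), mul_nonneg (hc k hk) (norm_nonneg _),
      mul_nonneg (hc l hl) (norm_nonneg _)]
  · have hcancel : ∀ m ∈ ({j, k, l} : Finset V),
        (c m * ‖x m‖) • (‖x m‖⁻¹ • x m) = c m • x m := fun m hm => by
      rw [mul_smul, smul_inv_smul₀ (norm_ne_zero_iff.2 (hx m hm))]
    rw [hu, Finset.sum_insert (by simp [hjk, hjl]), Finset.sum_insert (by simp [hkl]),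
      Finset.sum_singleton, ← hcancel j hj, ← hcancel k hk, ← hcancel l hl, add_assoc]
    rfl

/-! ### Face angles at the centre of the largest ball -/

/-- Multiplying two instances, with `x` the largest radius, gives the inequality to which the `π /
3` face-angle bound reduces. -/
lemma two_mul_sinh_le_sinh_add {x y : ℝ} (hy : 0 < y) (hyx : y ≤ x) :
    2 * Real.sinh y ≤ Real.sinh (x + y) := by
  have h1 : Real.sinh (2 * y) ≤ Real.sinh (x + y) := Real.sinh_le_sinh.2 (by linarith)
  rw [Real.sinh_two_mul] at h1
  have h2 := Real.sinh_pos_iff.2 hy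
  nlinarith [Real.one_le_cosh y]

/-- At the centre of the largest of four mutually tangent balls, the face angles of the tetrahedron
are at most `π / 3`. -/
lemma IsTangentBallTetrahedron.norm_mul_norm_le {V : Type*} {s : Finset V} {r : V → ℝ}
    {p : V → ℝ × E3} (hp : IsTangentBallTetrahedron s r p) (hr : ∀ j, 0 < r j) {i : V}
    (hi : i ∈ s) (hpi : p i = basePoint) (hmax : ∀ j ∈ s, r j ≤ r i) :
    (∀ j ∈ s, j ≠ i → (p j).2 ≠ 0) ∧ ∀ j ∈ s, j ≠ i → ∀ k ∈ s, k ≠ i → j ≠ k →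
      ‖(p j).2‖ * ‖(p k).2‖ ≤ 2 * ⟪(p j).2, (p k).2⟫ := by
  have hcoord : ∀ j ∈ s, j ≠ i →
      (p j).1 = Real.cosh (r i + r j) ∧ ‖(p j).2‖ = Real.sinh (r i + r j) := by
    intro j hj hji
    obtain ⟨h1, h2⟩ := hp.1 j hj
    have h3 := hp.2 i hi j hj hji.symm
    rw [lorentz, real_inner_self_eq_norm_sq] at h1
    have h4 : lorentz basePoint (p j) = -(p j).1 := by simp [lorentz, basePoint]
    rw [hpi, hyperbolicDist, h4, neg_neg] at h3
    have h5 : 1 ≤ (p j).1 := by nlinarith [sq_nonneg ‖(p j).2‖]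
    have h6 : (p j).1 = Real.cosh (r i + r j) := by rw [← h3, Real.cosh_arcosh h5]
    refine ⟨h6, ?_⟩
    have h7 : 0 < Real.sinh (r i + r j) := Real.sinh_pos_iff.2 (add_pos (hr i) (hr j))
    rw [← sq_eq_sq₀ (norm_nonneg _) h7.le, Real.sinh_sq, ← h6]
    linarith
  refine ⟨fun j hj hji => ?_, fun j hj hji k hk hki hjk => ?_⟩
  · rw [← norm_pos_iff, (hcoord j hj hji).2]
    exact Real.sinh_pos_iff.2 (add_pos (hr i) (hr j))
  · obtain ⟨t1, n1⟩ := hcoord j hj hji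
    obtain ⟨t2, n2⟩ := hcoord k hk hki
    have h := hp.2 j hj k hk hjk
    have hcs := real_inner_le_norm (p j).2 (p k).2
    have e1 := Real.cosh_sub (r i + r j) (r i + r k)
    have e2 := Real.one_le_cosh ((r i + r j) - (r i + r k))
    -- The law of cosines. Undoing `arcosh` needs its argument to be at least `1`, which follows
    -- from Cauchy–Schwarz for the space parts and `cosh ≥ 1` at the difference of the two edge
    -- lengths.
    have hin : ⟪(p j).2, (p k).2⟫ = (p j).1 * (p k).1 - Real.cosh (r j + r k) := by
      rw [← h, hyperbolicDist, Real.cosh_arcosh]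
      · rw [lorentz]; ring
      · rw [lorentz, t1, t2]
        rw [n1, n2] at hcs
        linarith
    have e3 : (r i + r j) - (r i + r k) = r j - r k := by ring
    rw [e3, Real.cosh_sub] at e1
    -- By `e1`, the inner product equals `sinh (r i + r j) sinh (r i + r k) - 2 sinh (r j) sinh (r
    -- k)`, so the goal becomes `g5`.
    rw [hin, t1, t2, n1, n2, Real.cosh_add (r j)]
    have g1 := two_mul_sinh_le_sinh_add (hr j) (hmax j hj)
    have g2 := two_mul_sinh_le_sinh_add (hr k) (hmax k hk)
    have g3 := Real.sinh_pos_iff.2 (hr j)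
    have g4 := Real.sinh_pos_iff.2 (hr k)
    have g5 : 2 * Real.sinh (r j) * (2 * Real.sinh (r k)) ≤
        Real.sinh (r i + r j) * Real.sinh (r i + r k) :=
      mul_le_mul g1 g2 (by positivity) (by linarith)
    linarith

/-- The bound holds for every placement of the tetrahedron, hence for the chosen one; the default
value `0` also satisfies it. -/
lemma solidAngle_le {V : Type*} {s : Finset V} {r : V → ℝ} (hs : s.card = 4)
    (hr : IsBallPacking r) {i : V} (hi : i ∈ s) (hmax : ∀ j ∈ s, r j ≤ r i) :
    solidAngle s r i ≤ 3 * Real.arccos (1 / 3) - Real.pi := by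
  classical
  unfold solidAngle
  split_ifs with h
  · obtain ⟨h0, h1⟩ := h.choose_spec.1.norm_mul_norm_le hr hi h.choose_spec.2 hmax
    refine coneSolidAngle_le ?_ ?_ ?_
    · rw [Finset.card_erase_of_mem hi, hs]
    · intro j hj
      rw [Finset.mem_erase] at hj
      exact h0 j hj.2 hj.1
    · intro j hj k hk hjk
      rw [Finset.mem_erase] at hj hk
      exact h1 j hj.2 hj.1 k hk.2 hk.1 hjk
  · exact regular_solid_angle_mem.1

/-! ### Virtual tetrahedra and the curvature at a largest ball -/

lemma coth_pos {x : ℝ} (hx : 0 < x) : 0 < coth x :=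
  div_pos (Real.cosh_pos x) (Real.sinh_pos_iff.2 hx)

lemma coth_le_coth {x y : ℝ} (hx : 0 < x) (hxy : x ≤ y) : coth y ≤ coth x := by
  rw [coth, coth, div_le_div_iff₀ (Real.sinh_pos_iff.2 (hx.trans_le hxy)) (Real.sinh_pos_iff.2 hx)]
  have h := Real.sinh_nonneg_iff.2 (sub_nonneg.2 hxy)
  rw [Real.sinh_sub] at h
  linarith

/-- The radii of a virtual tetrahedron do not lie in the virtual space of the largest ball. -/
lemma not_inVirtualSpace {V : Type*} {s : Finset V} {r : V → ℝ} (hs : s.card = 4)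
    (hr : IsBallPacking r) {i : V} (hi : i ∈ s) (hmax : ∀ j ∈ s, r j ≤ r i) :
    ¬ InVirtualSpace s r i := by
  classical
  unfold InVirtualSpace
  rw [not_le]
  have hcard : (s.erase i).card = 3 := by rw [Finset.card_erase_of_mem hi, hs]
  obtain ⟨j, hj⟩ : (s.erase i).Nonempty := by rw [← Finset.card_pos, hcard]; norm_num
  have h1 : coth (r i) ≤ coth (r j) := coth_le_coth (hr j) (hmax j (Finset.mem_of_mem_erase hj))
  have h2 : coth (r j) ≤ ∑ j ∈ s.erase i, coth (r j) :=
    Finset.single_le_sum (f := fun j => coth (r j)) (fun k _ => (coth_pos (hr k)).le) hj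
  have h3 : 0 ≤ ∑ e ∈ (s.erase i).powersetCard 2, ∏ j ∈ e, coth (r j) :=
    Finset.sum_nonneg fun e _ => Finset.prod_nonneg fun k _ => (coth_pos (hr k)).le
  have h4 : 0 < √((∑ e ∈ (s.erase i).powersetCard 2, ∏ j ∈ e, coth (r j)) + 1) :=
    Real.sqrt_pos.2 (by linarith)
  convert (by linarith : coth (r i) < ∑ j ∈ s.erase i, coth (r j) +
    2 * √((∑ e ∈ (s.erase i).powersetCard 2, ∏ j ∈ e, coth (r j)) + 1))

lemma extSolidAngle_le {V : Type*} {s : Finset V} {r : V → ℝ} (hs : s.card = 4)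
    (hr : IsBallPacking r) {i : V} (hi : i ∈ s) (hmax : ∀ j ∈ s, r j ≤ r i) :
    extSolidAngle s r i ≤ 3 * Real.arccos (1 / 3) - Real.pi := by
  unfold extSolidAngle
  split_ifs with h1 h2
  · exact solidAngle_le hs hr hi hmax
  · exact absurd h2 (not_inVirtualSpace hs hr hi hmax)
  · exact regular_solid_angle_mem.1

/-- Positivity amounts to `arccos (1/3) < 13π / 33`. As `cos (13π / 33) = sin (7π / 66) < 7π / 66`,
it suffices that `π < 22 / 7`. -/
lemma decayRate_pos : 0 < decayRate := by
  have h1 := Real.pi_gt_three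
  have h2 := Real.pi_lt_d4
  have h3 : Real.cos (13 * Real.pi / 33) < 1 / 3 := by
    rw [← Real.sin_pi_div_two_sub]
    refine (Real.sin_lt (by linarith)).trans ?_
    linarith
  have h4 : Real.arccos (1 / 3) < 13 * Real.pi / 33 := by
    rw [← Real.arccos_cos (x := 13 * Real.pi / 33) (by linarith) (by linarith)]
    exact Real.arccos_lt_arccos (Real.neg_one_le_cos _) h3 (by norm_num)
  rw [decayRate]
  linarith

/-- The curvature at the centre of a largest ball is at least `ε₀`. -/
lemma Triangulation.decayRate_le_extCurvature {V : Type*} [Fintype V] {M : Type*}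
    [TopologicalSpace M] (T : Triangulation V M) {r : V → ℝ} (hr : IsBallPacking r) {i : V}
    (hdeg : T.tetraDegree i ≤ 22) (hmax : ∀ j, r j ≤ r i) : decayRate ≤ T.extCurvature r i := by
  classical
  have hsum : ∑ s ∈ T.tetrahedra with i ∈ s, extSolidAngle s r i ≤
      ({s ∈ T.tetrahedra | i ∈ s}).card • (3 * Real.arccos (1 / 3) - Real.pi) := by
    refine Finset.sum_le_card_nsmul _ _ _ fun s hs => ?_
    rw [Finset.mem_filter] at hs
    have hs4 := hs.1
    simp only [tetrahedra, Finset.mem_filter] at hs4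
    exact extSolidAngle_le hs4.2.2 hr hs.2 fun j _ => hmax j
  have hdeg' : (({s ∈ T.tetrahedra | i ∈ s}).card : ℝ) ≤ 22 := by
    have : ({s ∈ T.tetrahedra | i ∈ s}).card ≤ 22 := by unfold tetraDegree at hdeg; convert hdeg
    exact_mod_cast this
  have h2 := mul_le_mul_of_nonneg_right hdeg' regular_solid_angle_mem.1
  rw [nsmul_eq_mul] at hsum
  have hK : T.extCurvature r i =
      4 * Real.pi - ∑ s ∈ T.tetrahedra with i ∈ s, extSolidAngle s r i := by
    unfold extCurvature
    congr!
  rw [hK, decayRate]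
  linarith

/-! ### Maximum principle and exponential decay -/

/-- If the derivatives of finitely many functions are nonpositive wherever these functions attain
the maximum, then the maximum does not increase. -/
lemma le_of_hasDerivWithinAt_nonpos_of_max {ι : Type*} [Fintype ι] [Nonempty ι]
    {g g' : ι → ℝ → ℝ} {a b : ℝ}
    (hg : ∀ i, ∀ x ∈ Icc a b, HasDerivWithinAt (g i) (g' i x) (Icc a b) x)
    (hmax : ∀ i, ∀ x ∈ Icc a b, (∀ j, g j x ≤ g i x) → g' i x ≤ 0) {m : ℝ}
    (ha : ∀ i, g i a ≤ m) (i : ι) {x : ℝ} (hx : x ∈ Icc a b) : g i x ≤ m := by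
  let f : ℝ → ℝ := fun x => Finset.univ.sup' Finset.univ_nonempty fun i => g i x
  have hle : ∀ i x, g i x ≤ f x := fun i x =>
    Finset.le_sup' (fun i => g i x) (Finset.mem_univ i)
  have hcont : ContinuousOn f (Icc a b) :=
    ContinuousOn.finset_sup'_apply _ fun i _ x hx => (hg i x hx).continuousWithinAt
  refine (hle i x).trans (image_le_of_liminf_slope_right_le_deriv_boundary hcont
    (B := fun _ => m) (B' := fun _ => 0) (Finset.sup'_le _ _ fun i _ => ha i) continuousOn_const
    (fun x _ => hasDerivWithinAt_const _ _ _) ?_ hx)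
  intro x hx r hr
  have hx' : x ∈ Icc a b := Ico_subset_Icc_self hx
  have hnhds : Icc a b ∈ 𝓝[>] x :=
    mem_of_superset (Ioo_mem_nhdsGT hx.2) fun z hz => ⟨hx.1.trans hz.1.le, hz.2.le⟩
  refine Eventually.frequently ?_
  -- Just to the right of `x`, every function stays below the line of slope `r > 0` through the
  -- maximum: the maximizing ones by their derivative, the others by continuity. Finiteness then
  -- bounds the slope of the maximum, which need not be differentiable.
  have hall : ∀ i, ∀ᶠ z in 𝓝[>] x, g i z < f x + r * (z - x) := by
    intro i
    have hd : HasDerivWithinAt (g i) (g' i x) (Ioi x) x := (hg i x hx').mono_of_mem_nhdsWithin hnhds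
    by_cases hi : ∀ j, g j x ≤ g i x
    · filter_upwards [hd.limsup_slope_le' (by simp) ((hmax i x hx' hi).trans_lt hr),
        self_mem_nhdsWithin] with z hz hzx
      rw [slope_def_field, div_lt_iff₀ (sub_pos.2 hzx)] at hz
      linarith [hle i x]
    · push Not at hi
      obtain ⟨j, hj⟩ := hi
      filter_upwards [hd.continuousWithinAt.eventually_lt_const (hj.trans_le (hle j x)),
        self_mem_nhdsWithin] with z hz hzx
      exact hz.trans (lt_add_of_pos_right _ (mul_pos hr (sub_pos.2 hzx)))
  filter_upwards [eventually_all.2 hall, self_mem_nhdsWithin] with z hz hzx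
  rw [slope_def_field, div_lt_iff₀ (sub_pos.2 hzx), sub_lt_iff_lt_add']
  exact (Finset.sup'_lt_iff _).2 fun i _ => hz i

lemma tanh_strictMono : StrictMono Real.tanh := by
  intro x y hxy
  rw [Real.tanh_eq_sinh_div_cosh, Real.tanh_eq_sinh_div_cosh,
    div_lt_div_iff₀ (Real.cosh_pos _) (Real.cosh_pos _)]
  have h := Real.sinh_pos_iff.2 (sub_pos.2 hxy)
  rw [Real.sinh_sub] at h
  linarith

lemma exists_maxRadius_eq {V : Type*} [Finite V] [Nonempty V] (r : V → ℝ) :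
    ∃ i, maxRadius r = r i ∧ ∀ j, r j ≤ r i := by
  obtain ⟨i, hi⟩ := Finite.exists_max r
  exact ⟨i, le_antisymm (ciSup_le hi) (le_ciSup (finite_range r).bddAbove i), hi⟩

lemma le_maxRadius {V : Type*} [Finite V] (r : V → ℝ) (i : V) : r i ≤ maxRadius r :=
  le_ciSup (finite_range r).bddAbove i

/-- The evolution of `tanh (ρ / 2) exp (ε t)` when `ρ' = -K sinh ρ`. -/
lemma hasDerivWithinAt_tanh_half_mul_exp {ρ : ℝ → ℝ} {s : Set ℝ} {t K ε : ℝ}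
    (h : HasDerivWithinAt ρ (-K * Real.sinh (ρ t)) s t) :
    HasDerivWithinAt (fun τ => Real.tanh (ρ τ / 2) * Real.exp (ε * τ))
      ((ε - K) * (Real.tanh (ρ t / 2) * Real.exp (ε * t))) s t := by
  have hc := Real.cosh_pos (ρ t / 2)
  have h1 := h.div_const 2
  have h2 := (h1.sinh.div h1.cosh hc.ne').mul
    (((hasDerivAt_id t).const_mul ε).exp.hasDerivWithinAt (s := s))
  have h3 : Real.sinh (ρ t) = 2 * Real.sinh (ρ t / 2) * Real.cosh (ρ t / 2) := by
    rw [← Real.sinh_two_mul]; congr 1; ring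
  have h4 := Real.cosh_sq (ρ t / 2)
  simp only [Real.tanh_eq_sinh_div_cosh]
  refine h2.congr_deriv ?_
  simp only [Pi.div_apply, id]
  rw [h3]
  field_simp
  linear_combination -K * Real.sinh (ρ t / 2) * h4

variable {V : Type*} [Fintype V] {M : Type*} [TopologicalSpace M]

/-- Along the extended flow, `tanh (r_M / 2)` decays exponentially. -/
theorem Triangulation.IsExtYamabeFlow.tanh_maxRadius_le [Nonempty V] {T : Triangulation V M}
    (hdeg : ∀ i, T.tetraDegree i ≤ 22) {b : EReal} {r : ℝ → V → ℝ} (h : T.IsExtYamabeFlow b r)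
    {t : ℝ} (ht : t ∈ timeInterval b) :
    Real.tanh (maxRadius (r t) / 2) ≤
      Real.tanh (maxRadius (r 0) / 2) * Real.exp (-decayRate * t) := by
  have hsub : Icc 0 t ⊆ timeInterval b := fun τ hτ =>
    ⟨hτ.1, (EReal.coe_le_coe_iff.2 hτ.2).trans_lt ht.2⟩
  have hderiv : ∀ i, ∀ x ∈ Icc 0 t, HasDerivWithinAt
      (fun τ => Real.tanh (r τ i / 2) * Real.exp (decayRate * τ))
      ((decayRate - T.extCurvature (r x) i) *
        (Real.tanh (r x i / 2) * Real.exp (decayRate * x))) (Icc 0 t) x := fun i x hx =>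
    hasDerivWithinAt_tanh_half_mul_exp (((h x (hsub hx)).2 i).mono hsub)
  have hmax : ∀ i, ∀ x ∈ Icc 0 t, (∀ j, Real.tanh (r x j / 2) * Real.exp (decayRate * x) ≤
      Real.tanh (r x i / 2) * Real.exp (decayRate * x)) →
      (decayRate - T.extCurvature (r x) i) *
        (Real.tanh (r x i / 2) * Real.exp (decayRate * x)) ≤ 0 := by
    intro i x hx hi
    have hr := (h x (hsub hx)).1
    -- The exponential factor is common to all vertices and `tanh` is strictly increasing, so a
    -- maximizing index belongs to a largest ball.
    have hi' : ∀ j, r x j ≤ r x i := fun j => by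
      have := tanh_strictMono.le_iff_le.1 (le_of_mul_le_mul_right (hi j) (Real.exp_pos _))
      linarith
    have htanh : 0 < Real.tanh (r x i / 2) := by
      rw [← Real.tanh_zero]
      exact tanh_strictMono (half_pos (hr i))
    exact mul_nonpos_of_nonpos_of_nonneg
      (sub_nonpos.2 (T.decayRate_le_extCurvature hr (hdeg i) hi')) (by positivity)
  obtain ⟨i, hi, -⟩ := exists_maxRadius_eq (r t)
  have key := le_of_hasDerivWithinAt_nonpos_of_max hderiv hmax
    (m := Real.tanh (maxRadius (r 0) / 2)) (fun j => ?_) i (right_mem_Icc.2 ht.1)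
  · rw [hi, neg_mul, Real.exp_neg, ← div_eq_mul_inv, le_div_iff₀ (Real.exp_pos _)]
    exact key
  · rw [mul_zero, Real.exp_zero, mul_one, tanh_strictMono.le_iff_le]
    linarith [le_maxRadius (r 0) j]

theorem Triangulation.IsExtYamabeFlow.tendsto_zero [Nonempty V] {T : Triangulation V M}
    (hdeg : ∀ i, T.tetraDegree i ≤ 22) {r : ℝ → V → ℝ} (h : T.IsExtYamabeFlow ⊤ r) :
    Tendsto r atTop (𝓝 0) := by
  have hmem : ∀ t : ℝ, 0 ≤ t → t ∈ timeInterval ⊤ := fun t ht => ⟨ht, EReal.coe_lt_top t⟩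
  have hlim : Tendsto (fun t : ℝ => Real.tanh (maxRadius (r 0) / 2) * Real.exp (-decayRate * t))
      atTop (𝓝 0) := by
    have h1 : Tendsto (fun t : ℝ => -decayRate * t) atTop atBot :=
      tendsto_id.const_mul_atTop_of_neg (neg_lt_zero.2 decayRate_pos)
    simpa using (Real.tendsto_exp_atBot.comp h1).const_mul (Real.tanh (maxRadius (r 0) / 2))
  rw [tendsto_pi_nhds]
  intro i
  rw [Pi.zero_apply, Metric.tendsto_nhds]
  intro η hη
  -- The decay controls only `tanh` of half the radius; comparison with `tanh (η / 2)` returns to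
  -- the radii by monotonicity.
  have hpos : 0 < Real.tanh (η / 2) := by
    rw [← Real.tanh_zero]
    exact tanh_strictMono (half_pos hη)
  filter_upwards [hlim.eventually_lt_const hpos, eventually_ge_atTop 0] with t ht ht0
  have h1 := (h.tanh_maxRadius_le hdeg (hmem t ht0)).trans_lt ht
  rw [tanh_strictMono.lt_iff_lt] at h1
  rw [Real.dist_eq, sub_zero, abs_of_pos ((h t (hmem t ht0)).1 i)]
  linarith [le_maxRadius (r t) i]

/-- A triangulation of a non-empty space has a vertex. -/
lemma Triangulation.nonempty_vertices [Nonempty M] (T : Triangulation V M) : Nonempty V := by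
  obtain ⟨m⟩ := ‹Nonempty M›
  obtain ⟨x, ⟨-, hx⟩, -⟩ := T.homeo.symm m
  by_contra hV
  rw [not_nonempty_iff] at hV
  simp at hx

end BallPacking

theorem theorem1p3 {V : Type*} [Fintype V] {M : Type*} [TopologicalSpace M] [T2Space M]
    [CompactSpace M] [Nonempty M] [ChartedSpace (EuclideanSpace ℝ (Fin 3)) M]
    (T : BallPacking.Triangulation V M) (hdeg : ∀ i, T.tetraDegree i ≤ 22) :
    (¬ ∃ r : V → ℝ, BallPacking.IsBallPacking r ∧ ∀ i, T.extCurvature r i = 0) ∧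
    0 < BallPacking.decayRate ∧
    (∀ (b : EReal) (r : ℝ → V → ℝ), T.IsExtYamabeFlow b r →
      ∀ t ∈ BallPacking.timeInterval b,
        Real.tanh (BallPacking.maxRadius (r t) / 2) ≤
          Real.tanh (BallPacking.maxRadius (r 0) / 2) *
            Real.exp (-BallPacking.decayRate * t)) ∧
    (∀ r : ℝ → V → ℝ, T.IsExtYamabeFlow ⊤ r →
      Filter.Tendsto r Filter.atTop (nhds 0)) := by
  have := T.nonempty_vertices
  refine ⟨?_, BallPacking.decayRate_pos, fun b r h t ht => h.tanh_maxRadius_le hdeg ht,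
    fun r h => h.tendsto_zero hdeg⟩
  rintro ⟨r, hr, hK⟩
  obtain ⟨i, -, hi⟩ := BallPacking.exists_maxRadius_eq r
  have h := T.decayRate_le_extCurvature hr (hdeg i) hi
  rw [hK i] at h
  exact h.not_gt BallPacking.decayRate_pos
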